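/- Let $F$ be an infinite (commutative) field, let $r\ge 2$ be an integer, and let $S$ be a Singer group of the projective space $\mathbf{PG}(r,F)$, that is, a group of automorphisms of the point-line geometry of $\mathbf{PG}(r,F)$ (permutations of the points that, together with their inverses, map lines to lines) acting sharply transitively on the points. Let $X\subseteq S$ be an independent set of generators of $S$ (that is, $X$ generates $S$ and no $x\in X$ lies in the subgroup generated by $X\setminus\{x\}$) whose cardinality $\omega=|X|$ is minimal among all independent sets of generators of $S$. Then $\omega=|F|$ or $F$ is countably infinite. If $F$ is countably infinite, then $\omega\neq|F|$ if and only if $\omega$ is finite, and in that case $F$ is not isomorphic (as a field) to the algebraic closure $\overline{\mathbb{Q}}$ of $\mathbb{Q}$. -/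

import Mathlib

open scoped LinearAlgebra.Projectivization Cardinal

/-- The point set of the projective space `PG(r, F)`: the one-dimensional subspaces of the
`F`-vector space `F ^ (r + 1)`. -/
abbrev PG (r : ℕ) (F : Type*) [Field F] : Type _ := ℙ F (Fin (r + 1) → F)

namespace PG

variable {r : ℕ} {F : Type*} [Field F]

/-- A set of points of `PG(r, F)` is a line if it consists of the points contained in some
two-dimensional vector subspace. -/
def IsLine (L : Set (PG r F)) : Prop :=
  ∃ W : Projectivization.Subspace F (Fin (r + 1) → F),
    Module.finrank F W.submodule = 2 ∧ L = (W : Set (PG r F))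

variable (r F) in
/-- The full automorphism group of the point-line geometry of `PG(r, F)`: the permutations of the
point set under which a set of points is a line if and only if its image is a line. -/
def autGroup : Subgroup (Equiv.Perm (PG r F)) where
  carrier := {g | ∀ L : Set (PG r F), IsLine (g '' L) ↔ IsLine L}
  one_mem' L := by simp
  mul_mem' {a b} ha hb L := by
    rw [Equiv.Perm.coe_mul, Set.image_comp]
    exact (ha _).trans (hb _)
  inv_mem' {a} ha L := by
    rw [← ha (⇑a⁻¹ '' L), ← Set.image_comp, ← Equiv.Perm.coe_mul, mul_inv_cancel,
      Equiv.Perm.coe_one, Set.image_id]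

/-- A Singer group of `PG(r, F)`: a group of automorphisms of `PG(r, F)` that acts sharply
transitively on the points. -/
structure IsSingerGroup (S : Subgroup (Equiv.Perm (PG r F))) : Prop where
  le_autGroup : S ≤ autGroup r F
  sharplyTransitive : ∀ x y : PG r F, ∃! g : Equiv.Perm (PG r F), g ∈ S ∧ g x = y

end PG

/-- `X` is an independent set of generators of the subgroup `S` of `G`: it generates `S`, and no
element of `X` lies in the subgroup generated by the other ones. -/
structure IsIndependentGeneratingSet {G : Type*} [Group G] (S : Subgroup G) (X : Set G) :
    Prop where
  closure_eq : Subgroup.closure X = S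
  independent : ∀ x ∈ X, x ∉ Subgroup.closure (X \ {x})

/-- `X` is an independent set of generators of `S` of minimal size. -/
structure IsMinimalIndependentGeneratingSet {G : Type*} [Group G] (S : Subgroup G) (X : Set G) :
    Prop where
  isIndependentGeneratingSet : IsIndependentGeneratingSet S X
  minimal : ∀ Y : Set G, IsIndependentGeneratingSet S Y → #X ≤ #Y

/-!
The cardinal statements follow from counting. A Singer group `S` has as many elements as
`PG(r, F)` has points, namely `#F`. A set of generators `X` of `S` satisfies
`#X ≤ #S ≤ max #X ℵ₀`, so that `#X = #F` unless `X` is finite, in which case `F` is countable.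

It remains to see that a finitely generated group of automorphisms of `PG(r, F)` cannot be
transitive on the points when `F` is an algebraic closure of `ℚ`. By the fundamental theorem of
projective geometry (`RepresentsCollineation.exists_semilinear`,
`PG.exists_semilinear_of_mem_autGroup`), each generator and each inverse of a generator is induced
by a semilinear map. The matrix entries of these finitely many maps lie in a number field `K`
that is normal over `ℚ`, hence stable under all the companion endomorphisms of `F`
(`exists_stable_intermediateField`). So the group preserves the set of points with homogeneous
coordinates in `K`, which is neither empty nor everything since `F` has infinite degree over `ℚ`
(`PG.exists_notMem_orbit_of_finite`).

For the fundamental theorem, fix a vector `v₀` and a complementary hyperplane `H`. The collineation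
restricts to a map `[v₀ + x] ↦ [w₀ + α x]` of affine spaces, where `[w₀]` is the image of `[v₀]`.
Then `α` is additive by the parallelogram construction (`affine_part_add`), and an additive map that
respects proportionality is semilinear (`exists_ringHom_smul_of_additive`).
-/

/-! ### The fundamental theorem of projective geometry -/

section

open Module Submodule

theorem mem_span_singleton_sup {F V : Type*} [Field F] [AddCommGroup V] [Module F V] {u v w : V} :
    w ∈ (F ∙ u) ⊔ (F ∙ v) ↔ ∃ a b : F, a • u + b • v = w := by
  rw [← span_insert, mem_span_pair]

/-- An additive map that preserves and reflects proportionality of vectors is semilinear if its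
domain has dimension at least two: the scalar `σ c` with `α (c • x) = σ c • α x` does not depend on
`x`, as comparing `α (c • (x + y))` with `α (c • x) + α (c • y)` for independent `x` and `y`
shows. -/
theorem exists_ringHom_smul_of_additive {F V W : Type*} [Field F] [AddCommGroup V] [Module F V]
    [AddCommGroup W] [Module F W] [Nontrivial V] (h2 : ∀ x : V, ∃ z, z ∉ F ∙ x) (α : V →+ W)
    (hα : ∀ x y : V, y ∈ F ∙ x ↔ α y ∈ F ∙ α x) :
    ∃ σ : F →+* F, ∀ (c : F) (x : V), α (c • x) = σ c • α x := by
  have h0 : ∀ x, α x = 0 → x = 0 := fun x hx => by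
    have := (hα 0 x).2 (by simp [hx])
    simpa using this
  have hc : ∀ (x : V) (c : F), ∃ d : F, d • α x = α (c • x) := fun x c =>
    mem_span_singleton.1 ((hα x (c • x)).1 (smul_mem _ _ (mem_span_singleton_self x)))
  choose s hs using hc
  have hind : ∀ x y : V, x ≠ 0 → y ∉ F ∙ x → s x = s y := by
    intro x y hx hy
    funext c
    have e : (s (x + y) c - s x c) • α x = (s y c - s (x + y) c) • α y := by
      have h := hs (x + y) c
      rw [smul_add, map_add, map_add, ← hs x c, ← hs y c, smul_add] at h
      rw [sub_smul, sub_smul, sub_eq_sub_iff_add_eq_add, h, add_comm]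
    have hy0 : s y c - s (x + y) c = 0 := by
      by_contra hne
      refine hy ((hα x y).2 (mem_span_singleton.2 ⟨(s y c - s (x + y) c)⁻¹ *
        (s (x + y) c - s x c), ?_⟩))
      rw [mul_smul, e, inv_smul_smul₀ hne]
    rw [hy0, zero_smul] at e
    have hx0 := (smul_eq_zero.1 e).resolve_right fun h => hx (h0 x h)
    rw [← sub_eq_zero.1 hx0, sub_eq_zero.1 hy0]
  -- proportional vectors are compared through a third one, independent of both
  have hall : ∀ x y : V, x ≠ 0 → y ≠ 0 → s x = s y := by
    intro x y hx hy
    by_cases hxy : y ∈ F ∙ x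
    · obtain ⟨z, hz⟩ := h2 x
      have hzy : z ∉ F ∙ y := fun h =>
        hz ((span_singleton_le_iff_mem _ _).2 hxy h)
      rw [hind x z hx hz, hind y z hy hzy]
    · exact hind x y hx hxy
  obtain ⟨x₀, hx₀⟩ := exists_ne (0 : V)
  have hαx₀ : α x₀ ≠ 0 := fun h => hx₀ (h0 _ h)
  have hmain : ∀ (c : F) (x : V), α (c • x) = s x₀ c • α x := by
    intro c x
    rcases eq_or_ne x 0 with rfl | hx
    · simp
    · rw [hall x₀ x hx₀ hx, hs]
  refine ⟨⟨⟨⟨s x₀, ?_⟩, ?_⟩, ?_, ?_⟩, hmain⟩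
  · refine smul_left_injective F hαx₀ ?_
    simp [hs]
  · intro a b
    refine smul_left_injective F hαx₀ ?_
    simp only [mul_smul, hs]
    rw [hmain]
  · refine smul_left_injective F hαx₀ ?_
    simp [hs]
  · intro a b
    refine smul_left_injective F hαx₀ ?_
    simp only [add_smul, hs, map_add]

/-- A map `φ` between vector spaces over `F`, encoding a map between the associated projective
spaces: `φ` chooses, for each nonzero vector `v`, a vector spanning the image of the point spanned
by `v`. Three points are collinear if and only if their images are; as `u`, `v` and `w` range over
all vectors, this also covers injectivity on points and `φ v ≠ 0` for `v ≠ 0`. No compatibility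
with the vector space operations is assumed. -/
structure RepresentsCollineation (F : Type*) {V W : Type*} [Field F] [AddCommGroup V] [Module F V]
    [AddCommGroup W] [Module F W] (φ : V → W) : Prop where
  map_zero : φ 0 = 0
  mem_sup_iff : ∀ u v w : V, w ∈ (F ∙ u) ⊔ (F ∙ v) ↔ φ w ∈ (F ∙ φ u) ⊔ (F ∙ φ v)

variable {F V W : Type*} [Field F] [AddCommGroup V] [Module F V] [AddCommGroup W] [Module F W]

/-- The affine part of a collineation. If `v₀ ∉ H`, the points `[v₀ + x]` with `x ∈ H` form an
affine space over `H`. The image of `[v₀ + x]` lies on the line through `[φ v₀]` and `[φ x]`,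
so it is `[φ v₀ + α x]` for a suitable vector `α x` that spans the image of `[x]`. -/
theorem exists_affine_part {φ : V → W} (hφ : RepresentsCollineation F φ)
    (H : Submodule F V) {v₀ : V} (hv₀ : v₀ ∉ H) :
    ∃ α : H → W, (∀ x : H, F ∙ α x = F ∙ φ x) ∧
      ∀ x : H, F ∙ (φ v₀ + α x) = F ∙ φ (v₀ + x) := by
  have h1 : ∀ u w : V, w ∈ (F ∙ u) ↔ φ w ∈ F ∙ φ u := fun u w => by
    simpa using hφ.mem_sup_iff u u w
  have hsp : ∀ u w : V, u ≠ 0 → u ∈ F ∙ w → F ∙ u = F ∙ w := fun u w hu h => by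
    obtain ⟨c, rfl⟩ := mem_span_singleton.1 h
    exact span_singleton_smul_eq (IsUnit.mk0 c (fun h => hu (by simp [h]))) w
  have key : ∀ x : H, ∃ y : W, F ∙ y = F ∙ φ x ∧ F ∙ (φ v₀ + y) = F ∙ φ (v₀ + x) := by
    intro x
    have hx0 : v₀ + (x : V) ∉ H := fun h => hv₀ ((H.add_mem_iff_left x.2).1 h)
    obtain ⟨a, b, hab⟩ := mem_span_singleton_sup.1 ((hφ.mem_sup_iff v₀ x (v₀ + x)).1
      (mem_span_singleton_sup.2 ⟨1, 1, by simp⟩))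
    have ha : a ≠ 0 := by
      rintro rfl
      have : v₀ + (x : V) ∈ F ∙ (x : V) :=
        (h1 _ _).2 (mem_span_singleton.2 ⟨b, by simpa using hab⟩)
      exact hx0 ((span_singleton_le_iff_mem _ _).2 x.2 this)
    have hw : φ v₀ + (a⁻¹ * b) • φ x = a⁻¹ • φ (v₀ + x) := by
      rw [← hab, smul_add, inv_smul_smul₀ ha, mul_smul]
    refine ⟨(a⁻¹ * b) • φ x, ?_, ?_⟩
    · rcases eq_or_ne (x : V) 0 with hx | hx
      · simp [hx, hφ.map_zero]
      have hb : b ≠ 0 := by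
        rintro rfl
        have : v₀ + (x : V) ∈ F ∙ v₀ :=
          (h1 _ _).2 (mem_span_singleton.2 ⟨a, by simpa using hab⟩)
        have hxv : (x : V) ∈ F ∙ v₀ := by
          simpa using sub_mem this (mem_span_singleton_self v₀)
        have : v₀ ∈ F ∙ (x : V) := by
          rw [hsp _ _ hx hxv]; exact mem_span_singleton_self v₀
        exact hv₀ ((span_singleton_le_iff_mem _ _).2 x.2 this)
      exact span_singleton_smul_eq (IsUnit.mk0 _ (mul_ne_zero (inv_ne_zero ha) hb)) _
    · rw [hw]
      exact span_singleton_smul_eq (IsUnit.mk0 _ (inv_ne_zero ha)) _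
  choose α hα using key
  exact ⟨α, fun x => (hα x).1, fun x => (hα x).2⟩

/-- The affine part of a collineation is additive. For independent `x` and `y` this is the
parallelogram rule, `[v₀ + x + y]` being the intersection of the line through `[v₀ + x]`
and `[y]` with the line through `[v₀ + y]` and `[x]`; the dependent
case follows from the independent one by means of a vector outside the span of `x`. -/
theorem affine_part_add {φ : V → W} (hφ : RepresentsCollineation F φ)
    {H : Submodule F V} {v₀ : V} (hv₀ : v₀ ∉ H) (h2 : ∀ x : H, ∃ z : H, z ∉ F ∙ x) {α : H → W}
    (hα : ∀ x : H, F ∙ α x = F ∙ φ x)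
    (hα' : ∀ x : H, F ∙ (φ v₀ + α x) = F ∙ φ (v₀ + x)) (x y : H) :
    α (x + y) = α x + α y := by
  have hz : α 0 = 0 := by simpa [hφ.map_zero] using hα 0
  have hmem : ∀ (w : W) (u : V) (S : Submodule F W), F ∙ w = F ∙ φ u → (w ∈ S ↔ φ u ∈ S) := by
    intro w u S h
    rw [← span_singleton_le_iff_mem, h, span_singleton_le_iff_mem]
  have hw₀ : ∀ x y : H, φ v₀ ∉ (F ∙ α x) ⊔ (F ∙ α y) := fun x y h => by
    rw [hα, hα, ← hφ.mem_sup_iff] at h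
    exact hv₀ (sup_le ((span_singleton_le_iff_mem _ _).2 x.2)
      ((span_singleton_le_iff_mem _ _).2 y.2) h)
  have hHmem : ∀ x y : H, α y ∈ F ∙ α x → y ∈ F ∙ x := fun x y h => by
    rw [hα, hmem _ _ _ (hα y)] at h
    have := (hφ.mem_sup_iff x x y).2 (by simpa using h)
    rw [sup_idem] at this
    obtain ⟨c, hc⟩ := mem_span_singleton.1 this
    exact mem_span_singleton.2 ⟨c, Subtype.ext hc⟩
  -- `[v₀ + x + y]` lies on the line through `[v₀ + x]` and `[y]`
  have step : ∀ x y : H, ∃ b : F, α (x + y) = α x + b • α y := by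
    intro x y
    have h1 : v₀ + ((x + y : H) : V) ∈ (F ∙ (v₀ + (x : V))) ⊔ (F ∙ (y : V)) :=
      mem_span_singleton_sup.2 ⟨1, 1, by simp [add_assoc]⟩
    rw [hφ.mem_sup_iff, ← hmem _ _ _ (hα' _), ← hα', ← hα, mem_span_singleton_sup] at h1
    obtain ⟨a, b, h⟩ := h1
    have h3 : (a - 1) • φ v₀ = α (x + y) - (a • α x + b • α y) := by
      rw [sub_smul, one_smul, sub_eq_sub_iff_add_eq_add, ← add_assoc, ← smul_add, h, add_comm]
    have hxy : α (x + y) ∈ (F ∙ α x) ⊔ (F ∙ α y) := by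
      rw [hmem _ _ _ (hα _), hα, hα, ← hφ.mem_sup_iff]
      exact mem_span_singleton_sup.2 ⟨1, 1, by simp⟩
    -- otherwise `φ v₀` would lie in the span of `α x` and `α y`, and `v₀` in `H`
    have ha : a - 1 = 0 := by
      by_contra hne
      refine hw₀ x y (((F ∙ α x) ⊔ (F ∙ α y)).smul_mem_iff hne |>.1 ?_)
      rw [h3]
      exact sub_mem hxy (mem_span_singleton_sup.2 ⟨a, b, rfl⟩)
    rw [ha, zero_smul, eq_comm, sub_eq_zero, sub_eq_zero.1 ha, one_smul] at h3
    exact ⟨b, h3⟩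
  have hind : ∀ x y : H, x ≠ 0 → y ∉ F ∙ x → α (x + y) = α x + α y := by
    intro x y hx hy
    obtain ⟨b, hb⟩ := step x y
    obtain ⟨d, hd⟩ := step y x
    rw [add_comm, hb] at hd
    have e : (1 - b) • α y = (1 - d) • α x := by
      rw [sub_smul, sub_smul, one_smul, one_smul, sub_eq_sub_iff_add_eq_add, ← hd, add_comm]
    have hb1 : 1 - b = 0 := by
      by_contra hne
      refine hy (hHmem x y (mem_span_singleton.2 ⟨(1 - b)⁻¹ * (1 - d), ?_⟩))
      rw [mul_smul, ← e, inv_smul_smul₀ hne]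
    rw [hb, ← sub_eq_zero.1 hb1, one_smul]
  rcases eq_or_ne x 0 with rfl | hx
  · simp [hz]
  rcases eq_or_ne y 0 with rfl | hy
  · simp [hz]
  by_cases hxy : y ∈ F ∙ x
  · obtain ⟨z, hzx⟩ := h2 x
    have hzy : z ∉ F ∙ y := fun h => hzx ((span_singleton_le_iff_mem _ _).2 hxy h)
    have h3 : y + z ∉ F ∙ x := fun h => hzx (((F ∙ x).add_mem_iff_right hxy).1 h)
    have e1 : α (x + y + z) = α x + α y + α z := by
      rw [add_assoc, hind x _ hx h3, hind y z hy hzy, add_assoc]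
    have e2 : α (x + y + z) = α (x + y) + α z := by
      rcases eq_or_ne (x + y) 0 with h | h
      · simp [h, hz]
      · exact hind _ _ h fun h' => hzx ((span_singleton_le_iff_mem _ _).2
          (add_mem (mem_span_singleton_self x) hxy) h')
    exact add_right_cancel (e2.symm.trans e1)
  · exact hind x y hx hxy

/-- The fundamental theorem of projective geometry in terms of vectors. The hypothesis on spans says
that `V` has dimension at least three. With a linear form `l` such that `l v₀ = 1`, the semilinear
map is `σ`-linear along `v₀` and the affine part `α` on the kernel of `l`. -/
theorem RepresentsCollineation.exists_semilinear (h3 : ∀ u v : V, ∃ w, w ∉ (F ∙ u) ⊔ (F ∙ v))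
    {φ : V → W} (hφ : RepresentsCollineation F φ) :
    ∃ (σ : F →+* F) (f : V →ₛₗ[σ] W), ∀ v, F ∙ f v = F ∙ φ v := by
  obtain ⟨v₀, hv₀⟩ := h3 0 0
  have hv₀' : v₀ ≠ 0 := by simpa using hv₀
  obtain ⟨l, hl⟩ := Module.Projective.exists_dual_ne_zero F hv₀'
  obtain ⟨l, hl⟩ : ∃ l : V →ₗ[F] F, l v₀ = 1 := ⟨(l v₀)⁻¹ • l, by simp [hl]⟩
  let H := LinearMap.ker l
  have hH : v₀ ∉ H := by simp [H, hl]
  -- the projection onto `H` along `v₀`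
  let p : V →ₗ[F] H := LinearMap.codRestrict H (LinearMap.id - l.smulRight v₀) (by simp [H, hl])
  have hp : ∀ v, v = l v • v₀ + (p v : V) := fun v => by
    have : (p v : V) = v - l v • v₀ := rfl
    rw [this, add_sub_cancel]
  have h2 : ∀ x : H, ∃ z : H, z ∉ F ∙ x := fun x => by
    obtain ⟨w, hw⟩ := h3 v₀ x
    refine ⟨p w, fun h => hw ?_⟩
    obtain ⟨c, hc⟩ := mem_span_singleton.1 h
    refine mem_span_singleton_sup.2 ⟨l w, c, ?_⟩
    conv_rhs => rw [hp w, ← hc]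
    simp
  have : Nontrivial H := by
    obtain ⟨z, hz⟩ := h2 0
    exact ⟨z, 0, by simpa using hz⟩
  obtain ⟨α, hα, hα'⟩ := exists_affine_part hφ H hH
  obtain ⟨σ, hσ⟩ := exists_ringHom_smul_of_additive h2
    (AddMonoidHom.mk' α (affine_part_add hφ hH h2 hα hα')) (fun x y => by
      have := hφ.mem_sup_iff x x y
      simp only [AddMonoidHom.mk'_apply]
      rw [sup_idem, sup_idem, ← hα, ← span_singleton_le_iff_mem, ← span_singleton_le_iff_mem,
        ← hα, span_singleton_le_iff_mem, span_singleton_le_iff_mem] at this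
      rw [← this, mem_span_singleton, mem_span_singleton]
      simp [Subtype.ext_iff])
  simp only [AddMonoidHom.mk'_apply] at hσ
  have hadd := affine_part_add hφ hH h2 hα hα'
  let f : V →ₛₗ[σ] W :=
    { toFun v := σ (l v) • φ v₀ + α (p v)
      map_add' u v := by simp only [map_add, hadd, add_smul]; abel
      map_smul' c v := by simp only [map_smul, hσ, smul_add, smul_eq_mul, map_mul, mul_smul] }
  refine ⟨σ, f, fun v => ?_⟩
  have hfv : f v = σ (l v) • φ v₀ + α (p v) := rfl
  rcases eq_or_ne (l v) 0 with hlv | hlv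
  · rw [hfv, hlv, _root_.map_zero, zero_smul, zero_add, hα]
    conv_rhs => rw [hp v, hlv, zero_smul, zero_add]
  · have hv : v = l v • (v₀ + ((l v)⁻¹ • p v : H)) := by
      conv_lhs => rw [hp v]
      rw [smul_add, ← Submodule.coe_smul, smul_inv_smul₀ hlv]
    have hf : f v = σ (l v) • (φ v₀ + α ((l v)⁻¹ • p v)) := by
      rw [hfv, smul_add, ← hσ, smul_inv_smul₀ hlv]
    rw [hf, span_singleton_smul_eq (IsUnit.mk0 _ (by simpa using hlv)), hα']
    set u := v₀ + (((l v)⁻¹ • p v : H) : V) with hu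
    have hs : ∀ a b : V, a ∈ F ∙ b → F ∙ φ a ≤ F ∙ φ b := fun a b h => by
      rw [span_singleton_le_iff_mem]
      simpa using (hφ.mem_sup_iff b b a).1 (by simpa using h)
    refine le_antisymm (hs _ _ (mem_span_singleton.2 ⟨(l v)⁻¹, ?_⟩))
      (hs _ _ (mem_span_singleton.2 ⟨l v, hv.symm⟩))
    exact (inv_smul_eq_iff₀ hlv).2 hv

theorem Projectivization.finrank_submodule_sup {F V : Type*} [Field F] [AddCommGroup V] [Module F V]
    {p q : ℙ F V} (h : p ≠ q) : finrank F (p.submodule ⊔ q.submodule : Submodule F V) = 2 := by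
  have hl := Projectivization.linearIndependent_pair_iff_ne.2 h
  have := finrank_span_eq_card hl
  rwa [Matrix.range_cons, Matrix.range_cons, Matrix.range_empty, Set.union_empty, span_union,
    ← Projectivization.submodule_eq, ← Projectivization.submodule_eq, Fintype.card_fin] at this

namespace PG

variable {r : ℕ} {F : Type*} [Field F]

/-- An automorphism preserves collinearity, also in the degenerate case `p = q`. -/
theorem submodule_le_sup_of_mem_autGroup {g : Equiv.Perm (PG r F)} (hg : g ∈ autGroup r F)
    {p q s : PG r F} (h : s.submodule ≤ p.submodule ⊔ q.submodule) :
    (g s).submodule ≤ (g p).submodule ⊔ (g q).submodule := by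
  rcases eq_or_ne p q with rfl | hpq
  · rw [sup_idem] at h ⊢
    rw [Projectivization.submodule_injective (eq_of_le_of_finrank_eq h
      (by rw [s.finrank_submodule, p.finrank_submodule]))]
  · let W := (p.submodule ⊔ q.submodule).projectivization
    have hmem : ∀ x : PG r F, x ∈ W ↔ x.submodule ≤ p.submodule ⊔ q.submodule := fun x =>
      Submodule.mem_projectivization_iff_submodule_le _ _
    have hW : IsLine (W : Set (PG r F)) :=
      ⟨W, (congrArg (fun U : Submodule F _ => finrank F U) (OrderIso.apply_symm_apply _ _)).trans
        (Projectivization.finrank_submodule_sup hpq), rfl⟩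
    obtain ⟨W', hW', e⟩ := (hg _).2 hW
    have hmem' : ∀ x : PG r F, x ∈ W → (g x).submodule ≤ W'.submodule := fun x hx => by
      have : g x ∈ (W' : Set (PG r F)) := e ▸ Set.mem_image_of_mem g hx
      rwa [← OrderIso.symm_apply_apply Projectivization.Subspace.submodule W', SetLike.mem_coe,
        Submodule.mem_projectivization_iff_submodule_le] at this
    rw [eq_of_le_of_finrank_eq (sup_le (hmem' p ((hmem p).2 le_sup_left))
      (hmem' q ((hmem q).2 le_sup_right)))
      ((Projectivization.finrank_submodule_sup (g.injective.ne hpq)).trans hW'.symm)]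
    exact hmem' s ((hmem s).2 h)

theorem submodule_le_sup_iff_of_mem_autGroup {g : Equiv.Perm (PG r F)} (hg : g ∈ autGroup r F)
    {p q s : PG r F} : (g s).submodule ≤ (g p).submodule ⊔ (g q).submodule ↔
      s.submodule ≤ p.submodule ⊔ q.submodule :=
  ⟨fun h => by simpa using submodule_le_sup_of_mem_autGroup (inv_mem hg) h,
    submodule_le_sup_of_mem_autGroup hg⟩

/-- The fundamental theorem of projective geometry for automorphisms of `PG(r, F)`, `r ≥ 2`: every
one is induced by a semilinear map. -/
theorem exists_semilinear_of_mem_autGroup (hr : 2 ≤ r) {g : Equiv.Perm (PG r F)}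
    (hg : g ∈ autGroup r F) :
    ∃ (σ : F →+* F) (f : (Fin (r + 1) → F) →ₛₗ[σ] (Fin (r + 1) → F)),
      ∀ (v : Fin (r + 1) → F) (hv : v ≠ 0), ∃ hfv : f v ≠ 0,
        g (Projectivization.mk F v hv) = Projectivization.mk F (f v) hfv := by
  classical
  let φ : (Fin (r + 1) → F) → (Fin (r + 1) → F) := fun v =>
    if hv : v ≠ 0 then (g (Projectivization.mk F v hv)).rep else 0
  have hφ0 : φ 0 = 0 := by simp [φ]
  have hφ1 : ∀ (v : Fin (r + 1) → F) (hv : v ≠ 0),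
      F ∙ φ v = (g (Projectivization.mk F v hv)).submodule := fun v hv => by
    simp only [φ, dif_pos hv, Projectivization.submodule_eq]
  have hone : ∀ u w : Fin (r + 1) → F, w ∈ (F ∙ u) ↔ φ w ∈ (F ∙ φ u) := by
    intro u w
    rcases eq_or_ne w 0 with rfl | hw
    · simp [hφ0]
    have hw' : φ w ≠ 0 := by
      simp only [φ, dif_pos hw]
      exact Projectivization.rep_nonzero _
    rcases eq_or_ne u 0 with rfl | hu
    · simp [hφ0, hw, hw']
    have := submodule_le_sup_iff_of_mem_autGroup hg (p := .mk F u hu) (q := .mk F u hu)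
      (s := .mk F w hw)
    rw [sup_idem, sup_idem, ← hφ1, ← hφ1, span_singleton_le_iff_mem,
      Projectivization.submodule_mk, Projectivization.submodule_mk,
      span_singleton_le_iff_mem] at this
    exact this.symm
  have hφ : RepresentsCollineation F φ := by
    refine ⟨hφ0, fun u v w => ?_⟩
    rcases eq_or_ne u 0 with rfl | hu
    · simpa [hφ0] using hone v w
    rcases eq_or_ne v 0 with rfl | hv
    · simpa [hφ0] using hone u w
    rcases eq_or_ne w 0 with rfl | hw
    · simp [hφ0]
    have := submodule_le_sup_iff_of_mem_autGroup hg (p := .mk F u hu) (q := .mk F v hv)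
      (s := .mk F w hw)
    rw [← hφ1, ← hφ1, ← hφ1, span_singleton_le_iff_mem,
      Projectivization.submodule_mk, Projectivization.submodule_mk, Projectivization.submodule_mk,
      span_singleton_le_iff_mem] at this
    exact this.symm
  have h3 : ∀ u v : Fin (r + 1) → F, ∃ w, w ∉ (F ∙ u) ⊔ (F ∙ v) := by
    intro u v
    by_contra! h
    have htop : (F ∙ u) ⊔ (F ∙ v) = ⊤ := eq_top_iff.2 fun w _ => h w
    rw [← span_insert] at htop
    have h1 := finrank_span_finset_le_card (R := F) ({u, v} : Finset (Fin (r + 1) → F))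
    rw [Set.finrank, Finset.coe_insert, Finset.coe_singleton, htop, finrank_top,
      finrank_fin_fun] at h1
    have := Finset.card_le_two (a := u) (b := v)
    omega
  obtain ⟨σ, f, hf⟩ := hφ.exists_semilinear h3
  refine ⟨σ, f, fun v hv => ?_⟩
  have hs := (hf v).trans (hφ1 v hv)
  have hfv : f v ≠ 0 := fun h => by
    have := Projectivization.finrank_submodule (g (.mk F v hv))
    rw [← hs, h, span_zero_singleton, finrank_bot] at this
    exact zero_ne_one this
  exact ⟨hfv, Projectivization.submodule_injective
    (hs.symm.trans (Projectivization.submodule_mk _ hfv).symm)⟩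

end PG

/-! ### Cardinalities -/

namespace PG

variable {r : ℕ} {F : Type*} [Field F]

theorem cardinalMk_eq [Infinite F] (hr : 1 ≤ r) : #(PG r F) = #F := by
  apply le_antisymm
  · calc #(PG r F) ≤ #(Fin (r + 1) → F) :=
          Cardinal.mk_le_of_injective (f := Projectivization.rep) fun p q h => by
            rw [← p.mk_rep, ← q.mk_rep]; simp only [h]
      _ = #F := by
        rw [Cardinal.mk_arrow, Cardinal.lift_uzero, Cardinal.mk_fin, Cardinal.lift_natCast,
          Cardinal.power_natCast, Cardinal.power_nat_eq (Cardinal.aleph0_le_mk F) (by omega)]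
  · obtain ⟨r, rfl⟩ := Nat.exists_eq_add_of_le' hr
    refine Cardinal.mk_le_of_injective
      (f := fun t : F => (Projectivization.mk F (Fin.cons 1 fun _ => t) fun h => by
        simpa using congrFun h 0 : PG (r + 1) F)) fun s t h => ?_
    obtain ⟨a, ha⟩ := (Projectivization.mk_eq_mk_iff' ..).1 h
    have h0 : a = 1 := by simpa using congrFun ha 0
    simpa [h0] using (congrFun ha 1).symm

theorem IsSingerGroup.cardinalMk_eq {S : Subgroup (Equiv.Perm (PG r F))} (hS : IsSingerGroup S) :
    #S = #(PG r F) := by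
  obtain ⟨p⟩ : Nonempty (PG r F) := inferInstance
  refine Cardinal.mk_congr (Equiv.ofBijective (fun g : S => (g : Equiv.Perm (PG r F)) p) ⟨?_, ?_⟩)
  · intro g h e
    exact Subtype.ext ((hS.sharplyTransitive p _).unique ⟨g.2, e⟩ ⟨h.2, rfl⟩)
  · intro q
    obtain ⟨g, hg, -⟩ := hS.sharplyTransitive p q
    exact ⟨⟨g, hg.1⟩, hg.2⟩

end PG

theorem Subgroup.cardinalMk_closure_le_max {G : Type*} [Group G] (X : Set G) :
    #(Subgroup.closure X) ≤ max #X ℵ₀ := by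
  rcases X.eq_empty_or_nonempty with rfl | hX
  · have : Countable (Subgroup.closure (∅ : Set G)) := by
      rw [Subgroup.closure_empty]; infer_instance
    exact (Cardinal.mk_le_aleph0).trans (le_max_right _ _)
  have := hX.to_subtype
  rw [← Cardinal.mk_freeGroup, ← Subtype.range_coe (s := X), ← FreeGroup.range_lift_eq_closure,
    Subtype.range_coe]
  exact Cardinal.mk_le_of_surjective (MonoidHom.rangeRestrict_surjective _)

/-! ### Subfields stable under endomorphisms -/

/-- In an infinite normal extension `F` of `k`, the normal closure of a finitely generated
subextension is a proper subextension that contains the generators and is stable under all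
endomorphisms of `F` over `k`. -/
theorem exists_stable_intermediateField {k F : Type*} [Field k] [Field F] [Algebra k F] [Normal k F]
    (hF : ¬ FiniteDimensional k F) {T : Set F} (hT : T.Finite) :
    ∃ K : IntermediateField k F, T ⊆ K ∧ (∀ (σ : F →ₐ[k] F), ∀ x ∈ K, σ x ∈ K) ∧ ∃ t, t ∉ K := by
  have : FiniteDimensional k (IntermediateField.adjoin k T) := by
    have := hT.to_subtype
    exact IntermediateField.finiteDimensional_adjoin fun x _ => Algebra.IsIntegral.isIntegral x
  let K := IntermediateField.normalClosure k (IntermediateField.adjoin k T) F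
  have hK : Normal k K := normalClosure.normal k _ F
  refine ⟨K, (IntermediateField.subset_adjoin k T).trans
    (SetLike.coe_subset_coe.2 (IntermediateField.le_normalClosure _)), fun σ x hx => ?_, ?_⟩
  · exact IntermediateField.normal_iff_forall_map_le.1 hK σ ⟨x, hx, rfl⟩
  · by_contra! h
    have htop : K = ⊤ := eq_top_iff.2 fun t _ => h t
    have : FiniteDimensional k K := normalClosure.is_finiteDimensional k _ F
    rw [htop] at this
    exact hF IntermediateField.topEquiv.toLinearEquiv.finiteDimensional

/-- An algebraically closed field of characteristic zero contains primitive `p`-th roots of unity,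
of degree `p - 1` over `ℚ`, for every prime `p`. -/
theorem not_finiteDimensional_rat_of_isAlgClosed (F : Type*) [Field F] [Algebra ℚ F]
    [IsAlgClosed F] : ¬ FiniteDimensional ℚ F := by
  intro h
  have := algebraRat.charZero F
  obtain ⟨p, hp, hprime⟩ := Nat.exists_infinite_primes (finrank ℚ F + 2)
  have : NeZero p := ⟨hprime.ne_zero⟩
  obtain ⟨ζ, hζ⟩ := HasEnoughRootsOfUnity.exists_primitiveRoot F p
  have h1 := minpoly.natDegree_le (A := ℚ) ζ
  have e : Polynomial.cyclotomic p ℚ = minpoly ℚ ζ := by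
    convert! Polynomial.cyclotomic_eq_minpoly_rat hζ hprime.pos
    -- two `ℚ`-algebra structures on `F`
    exact Subsingleton.elim _ _
  rw [← e, Polynomial.natDegree_cyclotomic, Nat.totient_prime hprime] at h1
  omega

/-- A field isomorphic to an algebraic closure of `ℚ` is an infinite normal extension of `ℚ`. -/
theorem exists_normal_of_ringEquiv_isAlgClosure {F Ω : Type*} [Field F] [Field Ω] [Algebra ℚ Ω]
    [IsAlgClosure ℚ Ω] (e : F ≃+* Ω) :
    ∃ _ : Algebra ℚ F, Normal ℚ F ∧ ¬ FiniteDimensional ℚ F := by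
  have := IsAlgClosure.isAlgClosed ℚ (K := Ω)
  have := IsAlgClosure.normal ℚ Ω
  let := (e.symm.toRingHom.comp (algebraMap ℚ Ω)).toAlgebra
  let e' : Ω ≃ₐ[ℚ] F := AlgEquiv.ofRingEquiv (f := e.symm) fun _ => rfl
  exact ⟨inferInstance, Normal.of_algEquiv e', fun _ =>
    not_finiteDimensional_rat_of_isAlgClosed Ω e'.symm.toLinearEquiv.finiteDimensional⟩

/-! ### Rational points -/

namespace PG

variable {r : ℕ} {F : Type*} [Field F]

/-- The points of `PG(r, F)` that are rational over the subfield `K`: those with some vector of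
homogeneous coordinates in `K`. -/
def rationalPoints (r : ℕ) {k : Type*} [Field k] [Algebra k F] (K : IntermediateField k F) :
    Set (PG r F) :=
  {p | ∃ (v : Fin (r + 1) → F) (hv : v ≠ 0), (∀ i, v i ∈ K) ∧ p = .mk F v hv}

theorem rationalPoints_nonempty {k : Type*} [Field k] [Algebra k F] (K : IntermediateField k F) :
    (rationalPoints r K).Nonempty :=
  ⟨_, fun _ => 1, fun h => one_ne_zero (congrFun h 0), fun _ => K.one_mem, rfl⟩

/-- The point `[1 : t : ⋯ : t]` is rational over `K` only if `t ∈ K`. -/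
theorem exists_notMem_rationalPoints (hr : 1 ≤ r) {k : Type*} [Field k] [Algebra k F]
    {K : IntermediateField k F} {t : F} (ht : t ∉ K) : ∃ p, p ∉ rationalPoints r K := by
  obtain ⟨r, rfl⟩ := Nat.exists_eq_add_of_le' hr
  refine ⟨.mk F (Fin.cons 1 fun _ => t) fun h => by simpa using congrFun h 0, ?_⟩
  rintro ⟨v, hv, hvK, h⟩
  obtain ⟨a, ha⟩ := (Projectivization.mk_eq_mk_iff' ..).1 h.symm
  have h0 : a = v 0 := by simpa using congrFun ha 0
  have h1 : a * t = v 1 := by simpa using congrFun ha 1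
  have ha0 : a ≠ 0 := by
    rintro rfl
    exact hv (by rw [← ha, zero_smul])
  apply ht
  rw [eq_div_of_mul_eq ha0 ((mul_comm _ _).trans h1), h0]
  exact K.div_mem (hvK 1) (hvK 0)

/-- A map induced by a `σ`-semilinear map preserves the `K`-rational points as soon as `σ` preserves
`K` and the matrix of the semilinear map has its entries in `K`. -/
theorem mapsTo_rationalPoints {k : Type*} [Field k] [Algebra k F] {K : IntermediateField k F}
    {g : Equiv.Perm (PG r F)} {σ : F →+* F}
    {f : (Fin (r + 1) → F) →ₛₗ[σ] (Fin (r + 1) → F)}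
    (hg : ∀ (v : Fin (r + 1) → F) (hv : v ≠ 0), ∃ hfv : f v ≠ 0,
      g (Projectivization.mk F v hv) = Projectivization.mk F (f v) hfv)
    (hσ : ∀ x ∈ K, σ x ∈ K) (hf : ∀ i j, f (Pi.single j 1) i ∈ K) :
    Set.MapsTo g (rationalPoints r K) (rationalPoints r K) := by
  rintro _ ⟨v, hv, hvK, rfl⟩
  obtain ⟨hfv, e⟩ := hg v hv
  refine ⟨f v, hfv, fun i => ?_, e⟩
  rw [pi_eq_sum_univ' v, map_sum, Finset.sum_apply]
  refine sum_mem fun j _ => ?_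
  rw [map_smulₛₗ, Pi.smul_apply, smul_eq_mul]
  refine mul_mem (hσ _ (hvK j)) ?_
  convert! hf i j using 3

/-- If `F` is an infinite normal extension of `ℚ`, then no finitely generated group of automorphisms
of `PG(r, F)` is transitive on the points: it preserves the points that are rational over a suitable
number field. -/
theorem exists_notMem_orbit_of_finite (hr : 2 ≤ r) [Algebra ℚ F] [Normal ℚ F]
    (hF : ¬ FiniteDimensional ℚ F) {X : Set (Equiv.Perm (PG r F))} (hX : X.Finite)
    (hXaut : X ⊆ autGroup r F) :
    ∃ p q : PG r F, ∀ g ∈ Subgroup.closure X, g p ≠ q := by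
  have key : ∀ g : autGroup r F, _ := fun g => exists_semilinear_of_mem_autGroup hr g.2
  choose σ f hf using key
  -- the matrix entries of the generators and of their inverses
  let T : Set F := ⋃ g ∈ {g : autGroup r F | (g : Equiv.Perm (PG r F)) ∈ X ∪ X⁻¹},
    Set.range fun ij : Fin (r + 1) × Fin (r + 1) => f g (Pi.single ij.2 1) ij.1
  have hT : T.Finite := Set.Finite.biUnion
    ((hX.union hX.inv).preimage Subtype.val_injective.injOn) fun g _ => Set.finite_range _
  obtain ⟨K, hTK, hK, t, ht⟩ := exists_stable_intermediateField hF hT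
  have hmaps : ∀ g ∈ X ∪ X⁻¹, Set.MapsTo g (rationalPoints r K) (rationalPoints r K) := by
    intro g hg
    have hga : g ∈ autGroup r F := hg.elim (fun h => hXaut h)
      fun h => inv_mem_iff.1 (hXaut (Set.mem_inv.1 h))
    exact mapsTo_rationalPoints (hf ⟨g, hga⟩) (hK (σ ⟨g, hga⟩).toRatAlgHom) fun i j =>
      hTK (Set.mem_biUnion (x := (⟨g, hga⟩ : autGroup r F)) hg ⟨(i, j), rfl⟩)
  have hclosure : ∀ g ∈ Subgroup.closure X,
      Set.MapsTo g (rationalPoints r K) (rationalPoints r K) := by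
    intro g hg
    rw [← Subgroup.mem_toSubmonoid, Subgroup.closure_toSubmonoid] at hg
    induction hg using Submonoid.closure_induction with
    | mem g hg => exact hmaps g hg
    | one => exact Set.mapsTo_id _
    | mul g h _ _ hg hh => exact hg.comp hh
  obtain ⟨p, hp⟩ := rationalPoints_nonempty (r := r) K
  obtain ⟨q, hq⟩ := exists_notMem_rationalPoints (by omega : 1 ≤ r) ht
  exact ⟨p, q, fun g hg e => hq (e ▸ hclosure g hg hp)⟩

end PG

end

/-! ### Generators of Singer groups -/

theorem mainTheorem7 {F : Type*} [Field F] [Infinite F] (r : ℕ) (hr : 2 ≤ r)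
    (S : Subgroup (Equiv.Perm (PG r F))) (hS : PG.IsSingerGroup S)
    (X : Set (Equiv.Perm (PG r F))) (hX : IsMinimalIndependentGeneratingSet S X)
    (ω : Cardinal) (hω : ω = #X) :
    (ω = #F ∨ #F = ℵ₀) ∧
      (#F = ℵ₀ → (ω ≠ #F ↔ ω < ℵ₀)) ∧
      (#F = ℵ₀ → ω ≠ #F → IsEmpty (F ≃+* AlgebraicClosure ℚ)) := by
  subst hω
  have hgen := hX.isIndependentGeneratingSet.closure_eq
  have hXS : X ⊆ S := hgen ▸ Subgroup.subset_closure
  have hSF : #S = #F := hS.cardinalMk_eq.trans (PG.cardinalMk_eq (by omega))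
  have hle : #X ≤ #F := hSF ▸ Cardinal.mk_le_mk_of_subset hXS
  have hge : #F ≤ max #X ℵ₀ := by
    rw [← hSF, ← hgen]
    exact Subgroup.cardinalMk_closure_le_max X
  have hF : ℵ₀ ≤ #F := Cardinal.aleph0_le_mk F
  refine ⟨?_, fun h => ?_, fun h hne => ⟨fun e => ?_⟩⟩
  · rcases le_total ℵ₀ #X with h | h
    · exact .inl (hle.antisymm (by rwa [max_eq_left h] at hge))
    · exact .inr (hF.antisymm' (by rwa [max_eq_right h] at hge))
  · rw [h] at hle ⊢
    exact ⟨hle.lt_of_ne, ne_of_lt⟩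
  · have hfin : X.Finite := Cardinal.lt_aleph0_iff_set_finite.1 (h ▸ hle.lt_of_ne hne)
    -- The instances are explicit because instance search endows `AlgebraicClosure ℚ` with the
    -- `ℚ`-algebra structure of a division ring of characteristic zero.
    obtain ⟨_, hnormal, hinf⟩ := @exists_normal_of_ringEquiv_isAlgClosure F (AlgebraicClosure ℚ) _ _
      (AlgebraicClosure.instAlgebra ℚ)
      ⟨AlgebraicClosure.isAlgClosed ℚ, AlgebraicClosure.isAlgebraic ℚ⟩ e
    obtain ⟨p, q, hpq⟩ := PG.exists_notMem_orbit_of_finite hr hinf hfin (hXS.trans hS.le_autGroup)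
    obtain ⟨g, ⟨hg, hgpq⟩, -⟩ := hS.sharplyTransitive p q
    exact hpq g (hgen ▸ hg) hgpq
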